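/- Let $E$ be a set and $X=\{X(t):t\in E\}$ a real-valued stochastic process on a probability space $(\Omega_0,P)$; let $X_1,X_2,\dots$ be i.i.d. copies of $X$ defined on a probability space $(\Omega,\mathcal A,Q)$. Write $$F(t,x)=P(X(t)\le x),\qquad F_n(t,x)=\frac1n\sum_{i=1}^n 1_{\{X_i(t)\le x\}},$$ $$\tau_\alpha(t)=\inf\{x:F(t,x)\ge\alpha\},\qquad \tau^n_\alpha(t)=\inf\{x:F_n(t,x)\ge\alpha\}\qquad(\alpha\in(0,1)).$$ *Convention.* For a set $S$, maps $Y_n:\Omega\to\mathbb R^S$ $(n\ge 1)$ and a real process $Z=\{Z_s:s\in S\}$ on some probability space, we say that $\{Y_n\}$ satisfies the CLT in $\ell_\infty(S)$ (sup norm) with Gaussian limit process $Z$ if $Z$ is a centered Gaussian process with almost surely bounded paths that has a Radon law on the Borel sets of $\ell_\infty(S)$, the outer probability $Q^*(Y_n\notin\ell_\infty(S))$ tends to $0$, and $E^*h(Y_n)\to E\,h(Z)$ for every bounded continuous $h:\ell_\infty(S)\to\mathbb R$, where $E^*$ is upper expectation and $Y_n$ is replaced by $0$ where it is unbounded. Assume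 the following. 1. For every $t\in E$ the distribution function $F(t,\cdot)$ is strictly increasing on $\mathbb R$ and has a density $f(t,\cdot)\ge 0$. 2. $\displaystyle\lim_{\delta\to0}\ \sup_{t\in E}\ \sup_{|u-v|\le\delta}|f(t,u)-f(t,v)|=0.$ 3. For every closed interval $I\subset(0,1)$ there is $\theta(I)>0$ such that $\displaystyle\inf_{t\in E,\ \alpha\in I,\ |x-\tau_\alpha(t)|\le\theta(I)}f(t,x)>0.$ 4. (Empirical CLT.) The empirical processes $\nu_n(t,x)=\sqrt n\,(F_n(t,x)-F(t,x))$ satisfy the CLT in $\ell_\infty(E\times\mathbb R)$ with Gaussian limit process $G=\{G(t,x)\}$, with covariance $$E\,G(s,x)G(t,y)=E\big[(1_{\{X(s)\le x\}}-F(s,x))(1_{\{X(t)\le y\}}-F(t,y))\big].$$ Then for every closed interval $I=[a,b]$ with $0<a\le b<1$, on the original probability space $(\Omega,\mathcal A,Q)$: (i) the processes $\{\sqrt n\,(\tau^n_\alpha(t)-\tau_\alpha(t))\,f(t,\tau_\alpha(t)):t\in E,\ \alpha\in I\}$ satisfy the CLT in $\ell_\infty(E\times I)$ with Gaussian limit process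 $\{G(t,\tau_\alpha(t)):t\in E,\ \alpha\in I\}$; (ii) the processes $\{\sqrt n\,(\tau^n_\alpha(t)-\tau_\alpha(t)):t\in E,\ \alpha\in I\}$ satisfy the CLT in $\ell_\infty(E\times I)$ with Gaussian limit process $\{G(t,\tau_\alpha(t))/f(t,\tau_\alpha(t)):t\in E,\ \alpha\in I\}$. -/

import Mathlib

open MeasureTheory ProbabilityTheory Filter Topology
open scoped ENNReal BoundedContinuousFunction

noncomputable section

/-- The Banach space `ℓ_∞(S)` of all bounded real functions on `S`, with the sup norm. -/
abbrev LInf (S : Type*) : Type _ := lp (fun _ : S => ℝ) ∞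

/-- `ℓ_∞(S)` carries its Borel σ-algebra. -/
instance instMeasurableSpaceLInf (S : Type*) : MeasurableSpace (LInf S) := borel _

instance instBorelSpaceLInf (S : Type*) : BorelSpace (LInf S) := ⟨rfl⟩

open scoped Classical in
/-- A real function on `S` as an element of `ℓ_∞(S)`; an unbounded function is sent to `0`.
(Where this is used, the set on which the function is unbounded is required to be null or
asymptotically null, so that the value there is immaterial.) -/
def toLInf {S : Type*} (y : S → ℝ) : LInf S :=
  if h : Memℓp (E := fun _ : S => ℝ) y ∞ then ⟨y, h⟩ else 0

/-- The upper expectation `E^* g` of a bounded, possibly non-measurable function `g`: the infimum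
of the expectations of the integrable random variables that dominate `g`. -/
def upperExpectation {Ω : Type*} [MeasurableSpace Ω] (μ : Measure Ω) (g : Ω → ℝ) : ℝ :=
  sInf {c : ℝ | ∃ φ : Ω → ℝ, Measurable φ ∧ Integrable φ μ ∧ (∀ ω, g ω ≤ φ ω) ∧ c = ∫ ω, φ ω ∂μ}

/-- The process `Z`, indexed by `S`, is a centered Gaussian process whose paths are almost surely
bounded and whose law on the Borel sets of `ℓ_∞(S)` exists and is Radon. -/
structure IsRadonCenteredGaussian {Ω S : Type*} [MeasurableSpace Ω] (μ : Measure Ω)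
    (Z : Ω → S → ℝ) : Prop where
  gaussian : IsGaussianProcess (fun s ω => Z ω s) μ
  centered : ∀ s, ∫ ω, Z ω s ∂μ = 0
  bounded : ∀ᵐ ω ∂μ, Memℓp (E := fun _ : S => ℝ) (Z ω) ∞
  aemeasurable : AEMeasurable (fun ω => toLInf (Z ω)) μ
  radon : (μ.map (fun ω => toLInf (Z ω))).InnerRegular

/-- The processes `Y n`, `n ≥ 1`, satisfy the central limit theorem in `ℓ_∞(S)` with Gaussian limit
process `Z`. The `Y n` need not be measurable as maps into `ℓ_∞(S)`, and their paths need only be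
bounded outside a set whose outer probability tends to `0` (`Q A` is the outer measure of `A` when
`A` is not measurable). If all paths of the `Y n` are bounded, this is the usual definition. -/
structure SatisfiesCLT {Ω Ω' S : Type*} [MeasurableSpace Ω] [MeasurableSpace Ω']
    (Q : Measure Ω) (Y : ℕ → Ω → S → ℝ) (Q' : Measure Ω') (Z : Ω' → S → ℝ) : Prop where
  limit : IsRadonCenteredGaussian Q' Z
  bounded : Tendsto (fun n => Q {ω | ¬ Memℓp (E := fun _ : S => ℝ) (Y n ω) ∞}) atTop (𝓝 0)
  tendsto : ∀ h : LInf S →ᵇ ℝ,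
    Tendsto (fun n => upperExpectation Q (fun ω => h (toLInf (Y n ω)))) atTop
      (𝓝 (∫ ω, h (toLInf (Z ω)) ∂Q'))

/-- `F(t, x) = P(X(t) ≤ x)`. -/
def marginalCDF {Ω₀ E : Type*} [MeasurableSpace Ω₀] (P : Measure Ω₀) (X : Ω₀ → E → ℝ)
    (t : E) (x : ℝ) : ℝ :=
  P.real {ω | X ω t ≤ x}

/-- `F_n(t, x) = (1/n) ∑_{i ≤ n} 1_{(-∞, x]}(X_i(t))`; the copies are `Xs 0, …, Xs (n - 1)`. -/
def empiricalCDF {Ω E : Type*} (Xs : ℕ → Ω → E → ℝ) (n : ℕ) (ω : Ω) (t : E) (x : ℝ) : ℝ :=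
  (1 / (n : ℝ)) * ∑ i ∈ Finset.range n, (Set.Iic x).indicator (fun _ => (1 : ℝ)) (Xs i ω t)

/-- The empirical process `ν_n(t, x) = √n (F_n(t, x) - F(t, x))`, indexed by `E × ℝ`. -/
def empiricalProcess {Ω₀ Ω E : Type*} [MeasurableSpace Ω₀] (P : Measure Ω₀) (X : Ω₀ → E → ℝ)
    (Xs : ℕ → Ω → E → ℝ) (n : ℕ) (ω : Ω) (s : E × ℝ) : ℝ :=
  √(n : ℝ) * (empiricalCDF Xs n ω s.1 s.2 - marginalCDF P X s.1 s.2)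

/-- The left-continuous inverse `α ↦ inf {x : H(x) ≥ α}` of a distribution function `H`. -/
def leftInverse (H : ℝ → ℝ) (α : ℝ) : ℝ := sInf {x | α ≤ H x}

/-- The quantile `τ_α(t)`. -/
def quantile {Ω₀ E : Type*} [MeasurableSpace Ω₀] (P : Measure Ω₀) (X : Ω₀ → E → ℝ)
    (α : ℝ) (t : E) : ℝ :=
  leftInverse (marginalCDF P X t) α

/-- The empirical quantile `τ^n_α(t)`. -/
def empiricalQuantile {Ω E : Type*} (Xs : ℕ → Ω → E → ℝ) (n : ℕ) (ω : Ω) (α : ℝ) (t : E) : ℝ :=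
  leftInverse (empiricalCDF Xs n ω t) α

/-- The CLT holds over the class `𝒞 = {C_{t,x}}`, `C_{t,x} = {z : z(t) ≤ x}`, with limit `G`:
the empirical processes satisfy the CLT in `ℓ_∞(E × ℝ)`, and `G` has the covariance
`E[(1{X_s ≤ x} - P(X_s ≤ x)) (1{X_t ≤ y} - P(X_t ≤ y))]`. -/
structure EmpiricalCLT {Ω₀ Ω Ω' E : Type*} [MeasurableSpace Ω₀] [MeasurableSpace Ω]
    [MeasurableSpace Ω'] (P : Measure Ω₀) (X : Ω₀ → E → ℝ) (Q : Measure Ω)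
    (Xs : ℕ → Ω → E → ℝ) (Q' : Measure Ω') (G : Ω' → E × ℝ → ℝ) : Prop where
  clt : SatisfiesCLT Q (empiricalProcess P X Xs) Q' G
  covariance : ∀ (s t : E) (x y : ℝ), ∫ ω, G ω (s, x) * G ω (t, y) ∂Q' =
    ∫ ω, ((Set.Iic x).indicator (fun _ => (1 : ℝ)) (X ω s) - marginalCDF P X s x) *
      ((Set.Iic y).indicator (fun _ => (1 : ℝ)) (X ω t) - marginalCDF P X t y) ∂P

/-- `f(t, ·)` is a (Lebesgue) probability density of `X(t)`, for every `t`. -/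
def HasMarginalDensities {Ω₀ E : Type*} [MeasurableSpace Ω₀] (P : Measure Ω₀) (X : Ω₀ → E → ℝ)
    (f : E → ℝ → ℝ) : Prop :=
  ∀ t, Measurable (f t) ∧ (∀ x, 0 ≤ f t x) ∧
    P.map (fun ω => X ω t) = volume.withDensity (fun x => ENNReal.ofReal (f t x))

/-- `lim_{δ → 0} sup_t sup_{|u - v| ≤ δ} |f(t, u) - f(t, v)| = 0`. -/
def UniformlyContinuousDensities {E : Type*} (f : E → ℝ → ℝ) : Prop :=
  ∀ ε > 0, ∃ δ > 0, ∀ (t : E) (u v : ℝ), |u - v| ≤ δ → |f t u - f t v| ≤ ε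

/-- For every closed interval `[a, b]` in `(0, 1)` there is `θ > 0` such that the infimum of
`f(t, x)` over `t`, `α ∈ [a, b]`, `|x - τ_α(t)| ≤ θ` is positive. -/
def DensitiesBoundedBelow {Ω₀ E : Type*} [MeasurableSpace Ω₀] (P : Measure Ω₀) (X : Ω₀ → E → ℝ)
    (f : E → ℝ → ℝ) : Prop :=
  ∀ a b : ℝ, 0 < a → a ≤ b → b < 1 → ∃ θ > 0, ∃ c > 0, ∀ (t : E), ∀ α ∈ Set.Icc a b,
    ∀ x : ℝ, |x - quantile P X α t| ≤ θ → c ≤ f t x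

end

/-!
The central limit theorem for empirical quantiles, uniformly in the time and in the level.

Linearization. Let `ν_n = √n (F_n - F)`. Since `F(t, ·)` is continuous and strictly increasing,
`F(t, τ_α(t)) = α`, and `τ^n_α(t)` separates the points where `F_n(t, ·) < α` from those where
`F_n(t, ·) ≥ α`. Comparing `F = F_n - ν_n / √n` with `α` on both sides of `τ^n_α(t)` gives
`√n (F(t, τ^n_α(t)) - α) ≈ -ν_n(t, τ_α(t))`, with an error that is at most the oscillation of
`ν_n(t, ·)` over the points where `F(t, ·)` is close to `α` (`abs_mul_leftInverse_sub_add_le`). No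
right continuity of `F_n` and no bound for its jumps is needed. The mean value theorem, the uniform
continuity of the densities and their lower bound near the quantiles then turn the left side into
`√n (τ^n_α(t) - τ_α(t)) f(t, τ_α(t))` (`abs_sub_sub_mul_le_of_abs_sub_lt`).

Equicontinuity. A Radon law on `ℓ_∞(S)` lives, up to small mass, on a compact set, and on the part
of a compact set that carries mass, coordinates that are close in probability are uniformly close
(`exists_isCompact_forall_abs_sub_le`). The increments of `G(t, ·)` are controlled in `L²` by those
of `F(t, ·)` (`EmpiricalCLT.measure_le_abs_sub_le`). Weak convergence keeps `ν_n` near the compact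
set with high probability (`eventually_measureReal_notMem_thickening_le`), so the oscillations of
`ν_n` above are asymptotically negligible, uniformly in `t`
(`EmpiricalCLT.eventually_equicontinuous`).

Transfer. Hence the quantile process is asymptotically equal to the image of `ν_n` under a bounded
linear operator on `ℓ_∞`, a substitution composed with multiplication by a bounded weight, and a
version of Slutsky's lemma for non-measurable maps with a Radon limit
(`tendsto_upperExpectation_of_tendsto_dist`) gives the convergence. The linearization carries a
minus sign; it is removed by the symmetry of centered Gaussian Radon laws
(`IsRadonCenteredGaussian.integral_neg`), which follows from that of the finite-dimensional
distributions because on compact sets all paths are nearly determined by finitely many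
coordinates. The weights `1` and `1 / f(t, τ_α(t))` yield the two statements.
-/

/-! ### Upper expectations and weak convergence with a Radon limit -/

section UpperExpectation

variable {Ω : Type*} [MeasurableSpace Ω] {Q : Measure Ω} [IsProbabilityMeasure Q]

theorem upperExpectation_le_integral {g φ : Ω → ℝ} {c : ℝ} (hg : ∀ ω, c ≤ g ω)
    (hφm : Measurable φ) (hφi : Integrable φ Q) (hgφ : ∀ ω, g ω ≤ φ ω) :
    upperExpectation Q g ≤ ∫ ω, φ ω ∂Q := by
  refine csInf_le ⟨c, ?_⟩ ⟨φ, hφm, hφi, hgφ, rfl⟩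
  rintro _ ⟨ψ, -, hψi, hψ, rfl⟩
  have h : ∫ _ω, c ∂Q ≤ ∫ ω, ψ ω ∂Q :=
    integral_mono (integrable_const c) hψi fun ω => (hg ω).trans (hψ ω)
  simpa using h

theorem le_upperExpectation {g : Ω → ℝ} {c d : ℝ} (hg : ∀ ω, g ω ≤ d)
    (h : ∀ φ : Ω → ℝ, Measurable φ → Integrable φ Q → (∀ ω, g ω ≤ φ ω) → c ≤ ∫ ω, φ ω ∂Q) :
    c ≤ upperExpectation Q g := by
  refine le_csInf ⟨_, fun _ => d, measurable_const, integrable_const d, hg, rfl⟩ ?_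
  rintro _ ⟨φ, hm, hi, hφ, rfl⟩
  exact h φ hm hi hφ

/-- Two functions bounded by `C` that satisfy `g ≤ g' + ε` outside a (possibly non-measurable) set
`B` have upper expectations that differ by at most `ε + 2 C Q^*(B)`. -/
theorem upperExpectation_le_add {g g' : Ω → ℝ} {C ε : ℝ} (hg : ∀ ω, |g ω| ≤ C)
    (hg' : ∀ ω, |g' ω| ≤ C) (hε : 0 ≤ ε) (B : Set Ω) (hB : ∀ ω, ω ∉ B → g ω ≤ g' ω + ε) :
    upperExpectation Q g ≤ upperExpectation Q g' + ε + 2 * C * Q.real B := by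
  rw [add_assoc, ← sub_le_iff_le_add]
  refine le_upperExpectation (fun ω => (abs_le.1 (hg' ω)).2) fun φ hφm hφi hφ => ?_
  rw [sub_le_iff_le_add]
  have hBm := measurableSet_toMeasurable Q B
  have hind : Integrable ((toMeasurable Q B).indicator fun _ => 2 * C) Q :=
    (integrable_const _).indicator hBm
  have hle := upperExpectation_le_integral (Q := Q) (g := g)
    (φ := fun ω => φ ω + (ε + (toMeasurable Q B).indicator (fun _ => 2 * C) ω))
    (fun ω => (abs_le.1 (hg ω)).1)
    (hφm.add ((measurable_const).add (measurable_const.indicator hBm)))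
    (hφi.add ((integrable_const ε).add hind)) (fun ω => by
      by_cases hω : ω ∈ toMeasurable Q B
      · rw [Set.indicator_of_mem hω]
        linarith [(abs_le.1 (hg ω)).2, (abs_le.1 (hg' ω)).1, hφ ω]
      · rw [Set.indicator_of_notMem hω]
        linarith [hB ω fun h => hω (subset_toMeasurable Q B h), hφ ω])
  rw [integral_add (g := fun ω => ε + (toMeasurable Q B).indicator (fun _ => 2 * C) ω) hφi
    ((integrable_const ε).add hind), integral_add (integrable_const ε) hind,
    integral_indicator_const _ hBm] at hle
  have : Q.real (toMeasurable Q B) = Q.real B := by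
    simp only [measureReal_def, measure_toMeasurable]
  simp only [this, integral_const, probReal_univ, smul_eq_mul] at hle
  linarith

theorem abs_upperExpectation_sub_le {g g' : Ω → ℝ} {C ε : ℝ} (hg : ∀ ω, |g ω| ≤ C)
    (hg' : ∀ ω, |g' ω| ≤ C) (hε : 0 ≤ ε) (B : Set Ω) (hB : ∀ ω, ω ∉ B → |g ω - g' ω| ≤ ε) :
    |upperExpectation Q g - upperExpectation Q g'| ≤ ε + 2 * C * Q.real B := by
  have h₁ := upperExpectation_le_add (Q := Q) hg hg' hε B fun ω hω => by
    linarith [(abs_le.1 (hB ω hω)).2]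
  have h₂ := upperExpectation_le_add (Q := Q) hg' hg hε B fun ω hω => by
    linarith [(abs_le.1 (hB ω hω)).1]
  rw [abs_le]
  constructor <;> linarith

/-- Markov's inequality for upper expectations and outer measures. -/
theorem measureReal_le_upperExpectation {g : Ω → ℝ} {d : ℝ} {A : Set Ω} (hg0 : ∀ ω, 0 ≤ g ω)
    (hgd : ∀ ω, g ω ≤ d) (hA : ∀ ω ∈ A, 1 ≤ g ω) : Q.real A ≤ upperExpectation Q g := by
  refine le_upperExpectation hgd fun φ _ hφi hφ => ?_
  have h := mul_meas_ge_le_integral_of_nonneg (μ := Q)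
    (Eventually.of_forall fun ω => (hg0 ω).trans (hφ ω)) hφi 1
  rw [one_mul] at h
  exact (measureReal_mono (s₂ := {ω | 1 ≤ φ ω}) fun ω hω => (hA ω hω).trans (hφ ω)).trans h

variable {M : Type*} [PseudoMetricSpace M] [MeasurableSpace M] [BorelSpace M] {μ : Measure M}
  [IsProbabilityMeasure μ]

/-- Weakly convergent maps eventually stay, up to small outer probability, in every neighbourhood
of a compact set that carries most of the mass of the limit law. -/
theorem eventually_measureReal_notMem_thickening_le {W : ℕ → Ω → M}
    (hW : ∀ h : M →ᵇ ℝ,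
      Tendsto (fun n => upperExpectation Q fun ω => h (W n ω)) atTop (𝓝 (∫ x, h x ∂μ)))
    {K : Set M} {η δ : ℝ} (hK : μ Kᶜ ≤ ENNReal.ofReal η) (hη : 0 < η) (hδ : 0 < δ) :
    ∀ᶠ n in atTop, Q.real {ω | W n ω ∉ Metric.thickening δ K} ≤ 2 * η := by
  have hcont : Continuous fun x => 1 - (thickenedIndicator hδ K x : ℝ) :=
    continuous_const.sub (NNReal.continuous_coe.comp (thickenedIndicator hδ K).continuous)
  have h0 : ∀ x, 0 ≤ 1 - (thickenedIndicator hδ K x : ℝ) := fun x => by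
    have := thickenedIndicator_le_one hδ K x
    have : (thickenedIndicator hδ K x : ℝ) ≤ 1 := by exact_mod_cast this
    linarith
  have h1 : ∀ x, 1 - (thickenedIndicator hδ K x : ℝ) ≤ 1 := fun x => by
    linarith [(thickenedIndicator hδ K x).coe_nonneg]
  let ψ : M →ᵇ ℝ := BoundedContinuousFunction.ofNormedAddCommGroup _ hcont 1 fun x => by
    rw [Real.norm_eq_abs, abs_le]
    exact ⟨by linarith [h0 x], h1 x⟩
  have hψ : ∀ x, ψ x = 1 - (thickenedIndicator hδ K x : ℝ) := fun x => rfl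
  have hint : ∫ x, ψ x ∂μ ≤ η := by
    have hm := measurableSet_toMeasurable μ Kᶜ
    calc ∫ x, ψ x ∂μ ≤ ∫ x, (toMeasurable μ Kᶜ).indicator (fun _ => (1 : ℝ)) x ∂μ := by
          refine integral_mono (ψ.integrable μ) ((integrable_const _).indicator hm) fun x => ?_
          by_cases hx : x ∈ toMeasurable μ Kᶜ
          · simp [hx, hψ]
          · have hxK : x ∈ K := by
              by_contra h
              exact hx (subset_toMeasurable μ _ h)
            simp [hx, hψ, thickenedIndicator_one hδ K hxK]
      _ = (μ Kᶜ).toReal := by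
          rw [integral_indicator_const _ hm, smul_eq_mul, mul_one, measureReal_def,
            measure_toMeasurable]
      _ ≤ η := ENNReal.toReal_le_of_le_ofReal hη.le hK
  filter_upwards [(hW ψ).eventually (gt_mem_nhds (show ∫ x, ψ x ∂μ < 2 * η by linarith))] with n hn
  refine le_trans ?_ hn.le
  refine measureReal_le_upperExpectation (d := 1) (fun ω => h0 _) (fun ω => h1 _) fun ω hω => ?_
  rw [hψ, thickenedIndicator_zero hδ K hω]
  simp

theorem exists_isCompact_measure_compl_le [μ.InnerRegular] {η : ℝ} (hη : 0 < η) :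
    ∃ K : Set M, IsCompact K ∧ IsClosed K ∧ μ Kᶜ ≤ ENNReal.ofReal η := by
  obtain ⟨K, -, hK, hKc, h⟩ := MeasurableSet.univ.exists_isCompact_isClosed_sdiff_lt
    (measure_ne_top μ _) (ENNReal.ofReal_pos.2 hη).ne'
  exact ⟨K, hK, hKc, by rw [Set.compl_eq_univ_sdiff]; exact h.le⟩

/-- Slutsky's lemma for maps that need not be measurable: maps whose distance to weakly convergent
ones tends to `0` in outer probability converge to the same limit, if the limit law is Radon.
The Radon property replaces the reduction to uniformly continuous test functions, since a
continuous function is uniformly continuous near a compact set. -/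
theorem tendsto_upperExpectation_of_tendsto_dist [μ.InnerRegular] {W Y : ℕ → Ω → M}
    (hW : ∀ h : M →ᵇ ℝ,
      Tendsto (fun n => upperExpectation Q fun ω => h (W n ω)) atTop (𝓝 (∫ x, h x ∂μ)))
    (hY : ∀ ε > 0, Tendsto (fun n => Q.real {ω | ε < dist (Y n ω) (W n ω)}) atTop (𝓝 0))
    (h : M →ᵇ ℝ) :
    Tendsto (fun n => upperExpectation Q fun ω => h (Y n ω)) atTop (𝓝 (∫ x, h x ∂μ)) := by
  suffices hdiff : Tendsto (fun n => upperExpectation Q (fun ω => h (Y n ω)) -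
      upperExpectation Q (fun ω => h (W n ω))) atTop (𝓝 0) by
    simpa using hdiff.add (hW h)
  rw [Metric.tendsto_nhds]
  intro ε hε
  have hC : 0 < ‖h‖ + 1 := by positivity
  obtain ⟨K, hK, -, hμK⟩ := exists_isCompact_measure_compl_le (μ := μ)
    (show 0 < ε / 16 / (‖h‖ + 1) by positivity)
  obtain ⟨δ, hδ, hunif⟩ := Metric.mem_uniformity_dist.1
    (hK.uniformContinuousAt_of_continuousAt h (fun a _ => h.continuous.continuousAt)
      (Metric.dist_mem_uniformity (show 0 < ε / 4 by positivity)))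
  filter_upwards [eventually_measureReal_notMem_thickening_le hW hμK (by positivity) (half_pos hδ),
    (hY (δ / 2) (half_pos hδ)).eventually
      (gt_mem_nhds (show 0 < ε / 16 / (‖h‖ + 1) by positivity))] with n hn₁ hn₂
  rw [Real.dist_eq, sub_zero]
  have hbd : ∀ x, |h x| ≤ ‖h‖ := fun x => h.norm_coe_le_norm x
  have hle := abs_upperExpectation_sub_le (Q := Q) (g := fun ω => h (Y n ω))
    (g' := fun ω => h (W n ω)) (C := ‖h‖) (ε := ε / 2) (fun ω => hbd _) (fun ω => hbd _)
    (by positivity) ({ω | W n ω ∉ Metric.thickening (δ / 2) K} ∪ {ω | δ / 2 < dist (Y n ω) (W n ω)})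
    (fun ω hω => by
      simp only [Set.mem_union, Set.mem_ofPred_eq, not_or, not_not, not_lt] at hω
      obtain ⟨z, hz, hWz⟩ := Metric.mem_thickening_iff.1 hω.1
      have h₁ : dist (h z) (h (W n ω)) < ε / 4 :=
        hunif (by rw [dist_comm]; linarith) hz
      have h₂ : dist (h z) (h (Y n ω)) < ε / 4 := by
        refine hunif ?_ hz
        have := dist_triangle (Y n ω) (W n ω) z
        rw [dist_comm]
        linarith [hω.2]
      have := dist_triangle_left (h (Y n ω)) (h (W n ω)) (h z)
      rw [← Real.dist_eq]
      linarith)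
  have hun := measureReal_union_le (μ := Q) {ω | W n ω ∉ Metric.thickening (δ / 2) K}
    {ω | δ / 2 < dist (Y n ω) (W n ω)}
  refine hle.trans_lt ?_
  have h₃ : 2 * ‖h‖ * Q.real ({ω | W n ω ∉ Metric.thickening (δ / 2) K} ∪
      {ω | δ / 2 < dist (Y n ω) (W n ω)}) ≤ 2 * ‖h‖ * (3 * (ε / 16 / (‖h‖ + 1))) := by
    gcongr
    linarith
  have h₄ : 2 * ‖h‖ * (3 * (ε / 16 / (‖h‖ + 1))) ≤ 3 * ε / 8 := by
    have : ‖h‖ * (ε / 16 / (‖h‖ + 1)) ≤ ε / 16 := by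
      rw [mul_div_assoc', div_le_iff₀ hC]
      nlinarith [norm_nonneg h]
    linarith
  linarith

end UpperExpectation

/-! ### The space `ℓ_∞(S)` -/

section LInf

variable {S S' : Type*}

theorem memℓp_infty_of_abs_le {y : S → ℝ} {C : ℝ} (h : ∀ s, |y s| ≤ C) :
    Memℓp (E := fun _ : S => ℝ) y ∞ :=
  memℓp_infty ⟨C, by rintro _ ⟨s, rfl⟩; exact h s⟩

theorem toLInf_apply {y : S → ℝ} (h : Memℓp (E := fun _ : S => ℝ) y ∞) (s : S) :
    toLInf y s = y s := by
  rw [toLInf, dif_pos h]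

theorem LInf.abs_apply_le_norm (x : LInf S) (s : S) : |x s| ≤ ‖x‖ :=
  lp.norm_apply_le_norm ENNReal.top_ne_zero x s

theorem LInf.abs_apply_sub_le_dist (x y : LInf S) (s : S) : |x s - y s| ≤ dist x y := by
  rw [dist_eq_norm]
  exact LInf.abs_apply_le_norm (x - y) s

theorem LInf.continuous_eval (s : S) : Continuous (fun x => x s : LInf S → ℝ) :=
  (LipschitzWith.of_dist_le_mul (K := 1) fun x y => by
    rw [NNReal.coe_one, one_mul]
    exact LInf.abs_apply_sub_le_dist x y s).continuous

theorem LInf.dist_le {x y : LInf S} {C : ℝ} (hC : 0 ≤ C) (h : ∀ s, |x s - y s| ≤ C) :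
    dist x y ≤ C := by
  rw [dist_eq_norm]
  exact lp.norm_le_of_forall_le hC h

/-- The weighted substitution operator `x ↦ (s ↦ m s * x (φ s))` from `ℓ_∞(S)` to `ℓ_∞(S')`, for
a weight `m` bounded by `C`. -/
noncomputable def weightedComp (φ : S' → S) (m : S' → ℝ) {C : ℝ} (hm : ∀ s, |m s| ≤ C) :
    LInf S →L[ℝ] LInf S' :=
  have hbd : ∀ (x : LInf S) (s : S'), |m s * x (φ s)| ≤ |C| * ‖x‖ := fun x s => by
    rw [abs_mul]
    exact mul_le_mul ((hm s).trans (le_abs_self C)) (LInf.abs_apply_le_norm x _) (abs_nonneg _)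
      (abs_nonneg _)
  LinearMap.mkContinuous
    { toFun := fun x => ⟨fun s => m s * x (φ s), memℓp_infty_of_abs_le (hbd x)⟩
      map_add' := fun x y => by
        ext s
        exact mul_add _ _ _
      map_smul' := fun c x => by
        ext s
        exact mul_left_comm _ _ _ }
    |C| fun x => lp.norm_le_of_forall_le (by positivity) (hbd x)

theorem weightedComp_apply (φ : S' → S) (m : S' → ℝ) {C : ℝ} (hm : ∀ s, |m s| ≤ C) (x : LInf S)
    (s : S') : weightedComp φ m hm x s = m s * x (φ s) := rfl

theorem toLInf_weightedComp (φ : S' → S) (m : S' → ℝ) {C : ℝ} (hm : ∀ s, |m s| ≤ C) {y : S → ℝ}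
    (hy : Memℓp (E := fun _ : S => ℝ) y ∞) :
    Memℓp (E := fun _ : S' => ℝ) (fun s => m s * y (φ s)) ∞ ∧
      toLInf (fun s => m s * y (φ s)) = weightedComp φ m hm (toLInf y) := by
  have h : (fun s => m s * y (φ s)) = ⇑(weightedComp φ m hm (toLInf y)) := by
    funext s
    rw [weightedComp_apply, toLInf_apply hy]
  have hmem : Memℓp (E := fun _ : S' => ℝ) (fun s => m s * y (φ s)) ∞ := by
    rw [h]
    exact lp.memℓp _
  refine ⟨hmem, ?_⟩
  ext s
  rw [toLInf_apply hmem, ← h]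

/-- A function within bounded distance of an element of `ℓ_∞(S)` is itself bounded. -/
theorem memℓp_and_dist_toLInf_le (x : LInf S) {y : S → ℝ} {ε : ℝ} (hε : 0 ≤ ε)
    (h : ∀ s, |y s - x s| ≤ ε) :
    Memℓp (E := fun _ : S => ℝ) y ∞ ∧ dist (toLInf y) x ≤ ε := by
  have hy : Memℓp (E := fun _ : S => ℝ) y ∞ := memℓp_infty_of_abs_le (C := ε + ‖x‖) fun s => by
    have := abs_add_le (y s - x s) (x s)
    rw [sub_add_cancel] at this
    linarith [h s, LInf.abs_apply_le_norm x s]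
  refine ⟨hy, LInf.dist_le hε fun s => ?_⟩
  rw [toLInf_apply hy]
  exact h s

/-- A compact subset of `ℓ_∞(S)` is almost determined by finitely many coordinates: there is a
substitution `φ : S → S` with finite range that moves every element of the compact set by at
most `ε`. -/
theorem exists_finite_range_abs_sub_le {K : Set (LInf S)} (hK : IsCompact K) {ε : ℝ} (hε : 0 < ε) :
    ∃ φ : S → S, (Set.range φ).Finite ∧ ∀ x ∈ K, ∀ s, |x (φ s) - x s| ≤ ε := by
  classical
  obtain ⟨t, -, htf, ht⟩ := Metric.totallyBounded_iff.1 hK.totallyBounded (ε / 4) (by positivity)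
    |>.imp fun t h => And.intro trivial h
  have := htf.fintype
  -- the finitely many centres embed `S` into a bounded subset of a finite-dimensional space
  let e : S → t → ℝ := fun s x => (x : LInf S) s
  have hbdd : Bornology.IsBounded (Set.range e) := by
    refine isBounded_iff_forall_norm_le.2 ⟨∑ x : t, ‖(x : LInf S)‖, ?_⟩
    rintro _ ⟨s, rfl⟩
    refine (pi_norm_le_iff_of_nonneg (Finset.sum_nonneg fun _ _ => norm_nonneg _)).2 fun x => ?_
    exact (LInf.abs_apply_le_norm (x : LInf S) s).trans
      (Finset.single_le_sum (f := fun x : t => ‖(x : LInf S)‖) (fun _ _ => norm_nonneg _)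
        (Finset.mem_univ x))
  obtain ⟨u, hu, huf, hcov⟩ := Metric.finite_approx_of_totallyBounded
    (hbdd.isCompact_closure.totallyBounded.subset subset_closure) (ε / 4) (by positivity)
  have hsel : ∀ s, ∃ y ∈ u, dist (e s) y < ε / 4 := fun s => by
    simpa using hcov (Set.mem_range_self s)
  choose r hru hr using hsel
  choose σ hσ using fun y : u => hu y.2
  have := huf.fintype
  refine ⟨fun s => σ ⟨r s, hru s⟩, (Set.finite_range σ).subset ?_, fun x hx s => ?_⟩
  · rintro _ ⟨s, rfl⟩
    exact ⟨⟨r s, hru s⟩, rfl⟩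
  · obtain ⟨c, hc, hxc⟩ := Set.mem_iUnion₂.1 (ht hx)
    have h₁ : |c (σ ⟨r s, hru s⟩) - c s| < ε / 4 := by
      have := (dist_le_pi_dist (e s) (r s) ⟨c, hc⟩).trans_lt (hr s)
      rw [show r s = e (σ ⟨r s, hru s⟩) from (hσ ⟨r s, hru s⟩).symm, dist_comm] at this
      exact this
    have h₂ := (LInf.abs_apply_sub_le_dist x c (σ ⟨r s, hru s⟩)).trans_lt hxc
    have h₃ := (LInf.abs_apply_sub_le_dist x c s).trans_lt hxc
    rw [abs_lt] at h₁ h₂ h₃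
    rw [abs_le]
    constructor <;> linarith

/-- A Radon law on `ℓ_∞(S)` is carried, up to mass `η`, by a compact set of paths that are
equicontinuous in probability: coordinates that are close in probability are uniformly close on
that compact set. -/
theorem exists_isCompact_forall_abs_sub_le {μ : Measure (LInf S)} [IsProbabilityMeasure μ]
    [μ.InnerRegular] {η ε : ℝ} (hη : 0 < η) (hε : 0 < ε) :
    ∃ K : Set (LInf S), IsCompact K ∧ μ Kᶜ ≤ ENNReal.ofReal η ∧ ∃ δ > (0 : ℝ),
      ∀ s t, μ {x : LInf S | ε ≤ |x s - x t|} < ENNReal.ofReal δ →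
        ∀ x ∈ K, |x s - x t| ≤ 5 * ε := by
  obtain ⟨K, hK, -, hμK⟩ := exists_isCompact_measure_compl_le (μ := μ) hη
  obtain ⟨c, hcK, hcf, hcov⟩ := Metric.finite_approx_of_totallyBounded hK.totallyBounded ε hε
  -- balls of the finite cover that carry no mass are discarded
  let c' : Set (LInf S) := {x ∈ c | μ (Metric.closedBall x ε) ≠ 0}
  have hc'f : c'.Finite := hcf.subset fun x hx => hx.1
  obtain ⟨δ, hδ, hδc⟩ : ∃ δ > (0 : ℝ), ∀ x ∈ c', ENNReal.ofReal δ ≤ μ (Metric.closedBall x ε) := by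
    have hpos : ∀ x ∈ c', 0 < (μ (Metric.closedBall x ε)).toReal := fun x hx =>
      ENNReal.toReal_pos hx.2 (measure_ne_top _ _)
    obtain ⟨δ, hδ, h⟩ : ∃ δ > (0 : ℝ), ∀ x ∈ c', δ ≤ (μ (Metric.closedBall x ε)).toReal := by
      rcases c'.eq_empty_or_nonempty with h | h
      · exact ⟨1, one_pos, by simp [h]⟩
      · obtain ⟨x, hx, hmin⟩ := hc'f.exists_minimalFor
          (fun x => (μ (Metric.closedBall x ε)).toReal) c' h
        refine ⟨_, hpos x hx, fun y hy => ?_⟩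
        by_contra! hlt
        exact absurd (hmin hy hlt.le) (not_le.2 hlt)
    exact ⟨δ, hδ, fun x hx => (ENNReal.ofReal_le_ofReal (h x hx)).trans_eq
      (ENNReal.ofReal_toReal (measure_ne_top _ _))⟩
  refine ⟨K ∩ ⋃ x ∈ c', Metric.closedBall x ε,
    hK.inter_right (hc'f.isClosed_biUnion fun _ _ => Metric.isClosed_closedBall), ?_, δ, hδ, ?_⟩
  · have hsub : (K ∩ ⋃ x ∈ c', Metric.closedBall x ε)ᶜ ⊆
        Kᶜ ∪ ⋃ x ∈ c \ c', Metric.closedBall x ε := by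
      intro x hx
      by_cases hxK : x ∈ K
      · obtain ⟨y, hy, hxy⟩ := Set.mem_iUnion₂.1 (hcov hxK)
        refine Or.inr (Set.mem_iUnion₂.2 ⟨y, ⟨hy, fun hyc => hx ⟨hxK, ?_⟩⟩,
          Metric.ball_subset_closedBall hxy⟩)
        exact Set.mem_iUnion₂.2 ⟨y, hyc, Metric.ball_subset_closedBall hxy⟩
      · exact Or.inl hxK
    have hnull : μ (⋃ x ∈ c \ c', Metric.closedBall x ε) = 0 := by
      refine (measure_biUnion_null_iff (hcf.subset Set.sdiff_subset).countable).2 fun x hx => ?_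
      by_contra h
      exact hx.2 ⟨hx.1, h⟩
    calc _ ≤ _ := measure_mono hsub
      _ ≤ _ := measure_union_le _ _
      _ ≤ _ := by rw [hnull, add_zero]; exact hμK
  · rintro s t hst x ⟨-, hx⟩
    obtain ⟨y, hy, hxy⟩ := Set.mem_iUnion₂.1 hx
    -- some path in the ball around `y` has a small increment, as the ball has mass at least `δ`
    obtain ⟨z, hz, hzst⟩ : ∃ z ∈ Metric.closedBall y ε, |z s - z t| < ε := by
      by_contra! h
      exact absurd ((hδc y hy).trans (measure_mono h)) (not_le.2 hst)
    have hxz : dist x z ≤ 2 * ε := by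
      have := dist_triangle_right x z y
      rw [Metric.mem_closedBall] at hz hxy
      linarith
    have h₁ := (LInf.abs_apply_sub_le_dist x z s).trans hxz
    have h₂ := (LInf.abs_apply_sub_le_dist x z t).trans hxz
    rw [abs_le] at h₁ h₂ ⊢
    rw [abs_lt] at hzst
    constructor <;> linarith

end LInf

/-! ### Centered Gaussian processes with a Radon law -/

section Gaussian

variable {S S' Ω' : Type*} [MeasurableSpace Ω'] {Q' : Measure Ω'}
  {Z : Ω' → S → ℝ}

theorem IsRadonCenteredGaussian.isProbabilityMeasure_map (hZ : IsRadonCenteredGaussian Q' Z) :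
    IsProbabilityMeasure (Q'.map fun ω => toLInf (Z ω)) :=
  have := hZ.gaussian.isProbabilityMeasure
  Measure.isProbabilityMeasure_map hZ.aemeasurable

theorem IsRadonCenteredGaussian.integral_map_eq (hZ : IsRadonCenteredGaussian Q' Z)
    (h : LInf S →ᵇ ℝ) :
    ∫ x, h x ∂(Q'.map fun ω => toLInf (Z ω)) = ∫ ω, h (toLInf (Z ω)) ∂Q' :=
  integral_map hZ.aemeasurable h.continuous.aestronglyMeasurable

theorem IsRadonCenteredGaussian.mul_comp (hZ : IsRadonCenteredGaussian Q' Z) (φ : S' → S)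
    (m : S' → ℝ) {C : ℝ} (hm : ∀ s, |m s| ≤ C) :
    IsRadonCenteredGaussian Q' (fun ω s => m s * Z ω (φ s)) := by
  have hae : (fun ω => toLInf fun s => m s * Z ω (φ s)) =ᵐ[Q']
      fun ω => weightedComp φ m hm (toLInf (Z ω)) := by
    filter_upwards [hZ.bounded] with ω hω
    exact (toLInf_weightedComp φ m hm hω).2
  have hT := (weightedComp φ m hm).continuous
  refine ⟨(hZ.gaussian.comp_right φ).smul m, fun s => ?_, ?_, ?_, ?_⟩
  · rw [integral_const_mul, hZ.centered, mul_zero]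
  · filter_upwards [hZ.bounded] with ω hω
    exact (toLInf_weightedComp φ m hm hω).1
  · exact (hT.measurable.comp_aemeasurable hZ.aemeasurable).congr hae.symm
  · rw [Measure.map_congr hae]
    have := hZ.radon
    have h := AEMeasurable.map_map_of_aemeasurable hT.aemeasurable hZ.aemeasurable
    rw [Function.comp_def] at h
    rw [← h]
    exact Measure.InnerRegular.map_of_continuous hT

/-- The finite-dimensional distributions of a centered Gaussian process are symmetric. -/
theorem IsRadonCenteredGaussian.map_neg_restrict (hZ : IsRadonCenteredGaussian Q' Z)
    (I : Finset S) :
    Q'.map (fun ω => -I.restrict (Z ω)) = Q'.map fun ω => I.restrict (Z ω) := by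
  have hI : HasGaussianLaw (fun ω => I.restrict (Z ω)) Q' := hZ.gaussian.hasGaussianLaw I
  have hmean : ∀ L : StrongDual ℝ (I → ℝ), ∫ ω, L (I.restrict (Z ω)) ∂Q' = 0 := fun L => by
    rw [L.integral_comp_comm hI.integrable]
    have : ∫ ω, I.restrict (Z ω) ∂Q' = 0 := by
      funext i
      rw [eval_integral (μ := Q') (f := fun ω => I.restrict (Z ω))
        fun i => (hZ.gaussian.hasGaussianLaw_eval (i : S)).integrable]
      exact hZ.centered i
    rw [this, map_zero]
  have := hI.isGaussian_map
  have := hI.fun_neg.isGaussian_map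
  refine Measure.ext_of_charFunDual (funext fun L => ?_)
  rw [hI.charFunDual_map_eq_fun, hI.fun_neg.charFunDual_map_eq_fun]
  have hvar : Var[fun ω => -L (I.restrict (Z ω)); Q'] = Var[fun ω => L (I.restrict (Z ω)); Q'] :=
    variance_neg
  simp only [map_neg, integral_neg, hmean, hvar, neg_zero]

/-- For a Radon law on `ℓ_∞(S)`, almost every path is the uniform limit of the paths obtained from
it by substitutions with finite range. -/
theorem exists_seq_finite_range_tendsto (μ : Measure (LInf S)) [IsProbabilityMeasure μ]
    [μ.InnerRegular] :
    ∃ φ : ℕ → S → S, (∀ k, (Set.range (φ k)).Finite) ∧ ∀ᵐ x ∂μ, Tendsto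
      (fun k => weightedComp (φ k) (fun _ => 1) (C := 1) (by simp) x) atTop (𝓝 x) := by
  choose K hK _ hμK using fun k : ℕ =>
    exists_isCompact_measure_compl_le (μ := μ) (Nat.one_div_pos_of_nat (α := ℝ) (n := k))
  have hacc : ∀ k, IsCompact (Set.accumulate K k) := fun k => by
    rw [Set.accumulate_def]
    exact (Set.finite_le_nat k).isCompact_biUnion fun i _ => hK i
  choose φ hφ hφK using fun k : ℕ =>
    exists_finite_range_abs_sub_le (hacc k) (Nat.one_div_pos_of_nat (α := ℝ) (n := k))
  refine ⟨φ, hφ, ?_⟩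
  have hfull : μ (⋃ k, K k)ᶜ = 0 := by
    have hlim : Tendsto (fun k : ℕ => ENNReal.ofReal (1 / ((k : ℝ) + 1))) atTop (𝓝 0) := by
      simpa using ENNReal.tendsto_ofReal tendsto_one_div_add_atTop_nhds_zero_nat
    refine le_antisymm (ge_of_tendsto' hlim fun k => ?_) zero_le
    exact (measure_mono (Set.compl_subset_compl.2 (Set.subset_iUnion K k))).trans (hμK k)
  have hae : ∀ᵐ x ∂μ, x ∈ ⋃ k, K k := hfull
  filter_upwards [hae] with x hx
  obtain ⟨j, hj⟩ := Set.mem_iUnion.1 hx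
  refine tendsto_iff_dist_tendsto_zero.2 (squeeze_zero' (Eventually.of_forall fun _ => dist_nonneg)
    ?_ tendsto_one_div_add_atTop_nhds_zero_nat)
  filter_upwards [eventually_ge_atTop j] with k hk
  refine LInf.dist_le (by positivity) fun s => ?_
  rw [weightedComp_apply, one_mul]
  exact hφK k x (Set.mem_accumulate.2 ⟨j, hk, hj⟩) s

/-- The law of a centered Gaussian process with a Radon law on `ℓ_∞(S)` is symmetric: by dominated
convergence the paths may be replaced by ones that depend linearly on finitely many coordinates. -/
theorem IsRadonCenteredGaussian.integral_neg (hZ : IsRadonCenteredGaussian Q' Z)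
    (h : LInf S →ᵇ ℝ) :
    ∫ ω, h (-toLInf (Z ω)) ∂Q' = ∫ ω, h (toLInf (Z ω)) ∂Q' := by
  have := hZ.gaussian.isProbabilityMeasure
  have := hZ.isProbabilityMeasure_map
  have := hZ.radon
  obtain ⟨φ, hφ, hlim⟩ := exists_seq_finite_range_tendsto (Q'.map fun ω => toLInf (Z ω))
  have hlim' := ae_of_ae_map hZ.aemeasurable hlim
  let π : ℕ → LInf S →L[ℝ] LInf S := fun k => weightedComp (φ k) (fun _ => 1) (C := 1) (by simp)
  have hconv : ∀ g : LInf S →ᵇ ℝ, Tendsto (fun k => ∫ ω, g (π k (toLInf (Z ω))) ∂Q') atTop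
      (𝓝 (∫ ω, g (toLInf (Z ω)) ∂Q')) := fun g => by
    refine tendsto_integral_of_dominated_convergence (fun _ => ‖g‖) (fun k => ?_)
      (integrable_const _) (fun k => Eventually.of_forall fun ω => g.norm_coe_le_norm _) ?_
    · exact ((g.continuous.comp (π k).continuous).measurable.comp_aemeasurable
        hZ.aemeasurable).aestronglyMeasurable
    · filter_upwards [hlim'] with ω hω
      exact (g.continuous.tendsto _).comp hω
  have hsymm : ∀ k, ∫ ω, h (-π k (toLInf (Z ω))) ∂Q' =
      ∫ ω, h (π k (toLInf (Z ω))) ∂Q' := fun k => by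
    let I : Finset S := (hφ k).toFinset
    have hI : ∀ s, φ k s ∈ I := fun s => (hφ k).mem_toFinset.2 (Set.mem_range_self s)
    have hbd : ∀ (v : I → ℝ) (s : S), |v ⟨φ k s, hI s⟩| ≤ ‖v‖ := fun v s => norm_le_pi_norm v _
    let R₀ : (I → ℝ) →ₗ[ℝ] LInf S :=
      { toFun := fun v => ⟨fun s => v ⟨φ k s, hI s⟩, memℓp_infty_of_abs_le (hbd v)⟩
        map_add' := fun _ _ => rfl
        map_smul' := fun _ _ => rfl }
    let R : (I → ℝ) →L[ℝ] LInf S := R₀.toContinuousLinearMap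
    have hR : ∀ᵐ ω ∂Q', π k (toLInf (Z ω)) = R (I.restrict (Z ω)) := by
      filter_upwards [hZ.bounded] with ω hω
      ext s
      change 1 * toLInf (Z ω) (φ k s) = Z ω (φ k s)
      rw [one_mul, toLInf_apply hω]
    have hIm : AEMeasurable (fun ω => I.restrict (Z ω)) Q' :=
      (hZ.gaussian.hasGaussianLaw I).aemeasurable
    have hcont : Continuous fun v => h (R v) := h.continuous.comp R.continuous
    calc ∫ ω, h (-π k (toLInf (Z ω))) ∂Q' = ∫ ω, h (R (-I.restrict (Z ω))) ∂Q' :=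
          integral_congr_ae (by
            filter_upwards [hR] with ω hω
            rw [hω, map_neg R])
      _ = ∫ v, h (R v) ∂(Q'.map fun ω => -I.restrict (Z ω)) :=
          (integral_map hIm.neg hcont.aestronglyMeasurable).symm
      _ = ∫ v, h (R v) ∂(Q'.map fun ω => I.restrict (Z ω)) := by rw [hZ.map_neg_restrict I]
      _ = ∫ ω, h (R (I.restrict (Z ω))) ∂Q' := integral_map hIm hcont.aestronglyMeasurable
      _ = ∫ ω, h (π k (toLInf (Z ω))) ∂Q' :=
          integral_congr_ae (by
            filter_upwards [hR] with ω hω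
            rw [hω])
  have hneg := hconv (h.compContinuous ⟨fun x => -x, continuous_neg⟩)
  exact tendsto_nhds_unique (hneg.congr hsymm) (hconv h)

end Gaussian

/-! ### Transfer of the central limit theorem -/

section CLT

variable {S S' Ω Ω' : Type*} [MeasurableSpace Ω] [MeasurableSpace Ω'] {Q : Measure Ω}
  {Q' : Measure Ω'} {Y : ℕ → Ω → S → ℝ}
  {Z : Ω' → S → ℝ}

/-- A Gaussian limit process may be replaced by its negative. -/
theorem SatisfiesCLT.neg_limit (hY : SatisfiesCLT Q Y Q' Z) :
    SatisfiesCLT Q Y Q' fun ω s => -Z ω s := by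
  have h1 : ∀ _s : S, |(-1 : ℝ)| ≤ 1 := by simp
  have hlim := hY.limit.mul_comp id (fun _ => -1) h1
  simp only [id, neg_one_mul] at hlim
  refine ⟨hlim, hY.bounded, fun h => ?_⟩
  convert hY.tendsto h using 2
  rw [← hY.limit.integral_neg h]
  refine integral_congr_ae ?_
  filter_upwards [hY.limit.bounded] with ω hω
  have hT := (toLInf_weightedComp id (fun _ => -1) h1 hω).2
  simp only [id, neg_one_mul] at hT
  congr 1
  rw [hT]
  ext s
  change -1 * toLInf (Z ω) s = -toLInf (Z ω) s
  rw [neg_one_mul]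

/-- The central limit theorem passes from processes `Y n` to processes that are asymptotically equal
to the images of the `Y n` under a weighted substitution operator. -/
theorem SatisfiesCLT.weightedComp_of_tendsto [IsProbabilityMeasure Q]
    (hY : SatisfiesCLT Q Y Q' Z) {Y' : ℕ → Ω → S' → ℝ}
    (φ : S' → S) (m : S' → ℝ) {C : ℝ} (hm : ∀ s, |m s| ≤ C)
    (hY' : ∀ ε > 0, Tendsto (fun n => Q.real
      {ω | ¬ ∀ s, |Y' n ω s - weightedComp φ m hm (toLInf (Y n ω)) s| ≤ ε}) atTop (𝓝 0)) :
    SatisfiesCLT Q Y' Q' fun ω s => m s * Z ω (φ s) := by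
  have hZ' := hY.limit.mul_comp φ m hm
  have := hZ'.isProbabilityMeasure_map
  have := hZ'.radon
  refine ⟨hZ', ?_, fun h => ?_⟩
  · have hreal := (ENNReal.tendsto_ofReal (hY' 1 one_pos))
    simp only [measureReal_def, ENNReal.ofReal_toReal (measure_ne_top _ _), ENNReal.ofReal_zero]
      at hreal
    refine tendsto_of_tendsto_of_tendsto_of_le_of_le tendsto_const_nhds hreal
      (fun _ => zero_le) fun n => measure_mono fun ω hω hle => ?_
    exact hω (memℓp_and_dist_toLInf_le _ zero_le_one hle).1
  · rw [← hZ'.integral_map_eq h]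
    refine tendsto_upperExpectation_of_tendsto_dist
      (W := fun n ω => weightedComp φ m hm (toLInf (Y n ω))) (fun g => ?_) (fun ε hε => ?_) h
    · rw [hZ'.integral_map_eq g]
      convert hY.tendsto (g.compContinuous ⟨_, (weightedComp φ m hm).continuous⟩) using 2
      · rfl
      refine integral_congr_ae ?_
      filter_upwards [hY.limit.bounded] with ω hω
      rw [(toLInf_weightedComp φ m hm hω).2]
      rfl
    · refine squeeze_zero (fun _ => measureReal_nonneg) (fun n => measureReal_mono ?_) (hY' ε hε)
      intro ω hω hle
      exact not_lt.2 (memℓp_and_dist_toLInf_le _ hε.le hle).2 hω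

end CLT

/-! ### Distribution functions and quantiles -/

section Quantile

variable {E Ω₀ : Type*} [MeasurableSpace Ω₀] {P : Measure Ω₀} [IsProbabilityMeasure P]
  {X : Ω₀ → E → ℝ} {f : E → ℝ → ℝ}

theorem marginalCDF_eq_cdf (hX : Measurable X) (t : E) (x : ℝ) :
    marginalCDF P X t x = cdf (P.map fun ω => X ω t) x := by
  have hXt : Measurable fun ω => X ω t := (measurable_pi_apply t).comp hX
  have := Measure.isProbabilityMeasure_map (μ := P) hXt.aemeasurable
  rw [cdf_eq_real, map_measureReal_apply hXt measurableSet_Iic]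
  rfl

theorem UniformlyContinuousDensities.continuous (hfuc : UniformlyContinuousDensities f) (t : E) :
    Continuous (f t) := by
  refine Metric.continuous_iff.2 fun u ε hε => ?_
  obtain ⟨δ, hδ, h⟩ := hfuc (ε / 2) (half_pos hε)
  exact ⟨δ, hδ, fun v hv => (h t v u hv.le).trans_lt (half_lt_self hε)⟩

theorem hasDerivAt_marginalCDF (hX : Measurable X) (hf : HasMarginalDensities P X f)
    (hfuc : UniformlyContinuousDensities f) (t : E) (x : ℝ) :
    HasDerivAt (marginalCDF P X t) (f t x) x := by
  obtain ⟨hfm, hf0, hmap⟩ := hf t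
  have hXt : Measurable fun ω => X ω t := (measurable_pi_apply t).comp hX
  have hprob := Measure.isProbabilityMeasure_map (μ := P) hXt.aemeasurable
  have hint : Integrable (f t) := by
    refine ⟨hfm.aestronglyMeasurable, ?_⟩
    rw [hasFiniteIntegral_iff_ofReal (Eventually.of_forall hf0), ← setLIntegral_univ,
      ← withDensity_apply _ MeasurableSet.univ, ← hmap]
    exact measure_lt_top _ _
  have hF : ∀ y, marginalCDF P X t y = ∫ u in Set.Iic y, f t u := fun y => by
    have := map_measureReal_apply (μ := P) hXt (measurableSet_Iic (a := y))
    rw [hmap, measureReal_def, withDensity_apply _ measurableSet_Iic,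
      ← ofReal_integral_eq_lintegral_ofReal hint.integrableOn (Eventually.of_forall hf0),
      ENNReal.toReal_ofReal (integral_nonneg hf0)] at this
    exact this.symm
  have hF' : marginalCDF P X t = fun y => marginalCDF P X t 0 + ∫ u in (0 : ℝ)..y, f t u := by
    funext y
    rw [← intervalIntegral.integral_Iic_sub_Iic hint.integrableOn hint.integrableOn, hF, hF]
    ring
  rw [hF']
  exact ((hfuc.continuous t).integral_hasStrictDerivAt 0 x).hasDerivAt.const_add _

/-- A strictly increasing continuous distribution function takes the value `α` at its
`α`-quantile. -/
theorem marginalCDF_quantile (hX : Measurable X) {t : E} (hF : StrictMono (marginalCDF P X t))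
    (hFc : Continuous (marginalCDF P X t)) {α : ℝ} (hα : α ∈ Set.Ioo (0 : ℝ) 1) :
    marginalCDF P X t (quantile P X α t) = α := by
  have heq : marginalCDF P X t = cdf (P.map fun ω => X ω t) := funext (marginalCDF_eq_cdf hX t)
  obtain ⟨y, hy⟩ : ∃ y, marginalCDF P X t y ≤ α := by
    have := (tendsto_cdf_atBot (P.map fun ω => X ω t)).eventually (gt_mem_nhds hα.1)
    rw [← heq] at this
    exact this.exists.imp fun _ h => h.le
  obtain ⟨z, hz⟩ : ∃ z, α ≤ marginalCDF P X t z := by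
    have := (tendsto_cdf_atTop (P.map fun ω => X ω t)).eventually (lt_mem_nhds hα.2)
    rw [← heq] at this
    exact this.exists.imp fun _ h => h.le
  obtain ⟨x, hx⟩ := mem_range_of_exists_le_of_exists_ge hFc ⟨y, hy⟩ ⟨z, hz⟩
  have hset : {u | α ≤ marginalCDF P X t u} = Set.Ici x := by
    ext u
    rw [Set.mem_ofPred_eq, Set.mem_Ici, ← hx, hF.le_iff_le]
  rw [quantile, leftInverse, hset, csInf_Ici, hx]

end Quantile

section EmpiricalCDF

variable {E Ω : Type*} {Xs : ℕ → Ω → E → ℝ}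

theorem empiricalCDF_mono (n : ℕ) (ω : Ω) (t : E) : Monotone (empiricalCDF Xs n ω t) := by
  intro x y hxy
  unfold empiricalCDF
  gcongr

theorem empiricalCDF_nonneg (n : ℕ) (ω : Ω) (t : E) (x : ℝ) : 0 ≤ empiricalCDF Xs n ω t x :=
  mul_nonneg (by positivity)
    (Finset.sum_nonneg fun _ _ => Set.indicator_nonneg (fun _ _ => zero_le_one) _)

theorem empiricalCDF_le_one (n : ℕ) (ω : Ω) (t : E) (x : ℝ) : empiricalCDF Xs n ω t x ≤ 1 := by
  have hsum : ∑ i ∈ Finset.range n, (Set.Iic x).indicator (fun _ => (1 : ℝ)) (Xs i ω t) ≤ n := by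
    refine (Finset.sum_le_sum fun i _ => Set.indicator_le_self' (fun _ _ => zero_le_one) _).trans ?_
    simp
  calc empiricalCDF Xs n ω t x ≤ 1 / (n : ℝ) * n := by
        unfold empiricalCDF
        gcongr
    _ ≤ 1 := by rw [one_div]; exact inv_mul_le_one

theorem bddBelow_le_empiricalCDF (n : ℕ) (ω : Ω) (t : E) {α : ℝ} (hα : 0 < α) :
    BddBelow {x | α ≤ empiricalCDF Xs n ω t x} := by
  obtain ⟨b, hb⟩ := ((Finset.range n).image fun i => Xs i ω t).bddBelow
  refine ⟨b, fun x hx => ?_⟩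
  by_contra! hlt
  rw [Set.mem_ofPred_eq] at hx
  refine absurd hx (not_le.2 ?_)
  have hzero : empiricalCDF Xs n ω t x = 0 := by
    refine mul_eq_zero_of_right _ (Finset.sum_eq_zero fun i hi => Set.indicator_of_notMem ?_ _)
    exact not_le.2 (hlt.trans_le (hb (Finset.mem_coe.2 (Finset.mem_image_of_mem _ hi))))
  rwa [hzero]

theorem nonempty_le_empiricalCDF {n : ℕ} (hn : n ≠ 0) (ω : Ω) (t : E) {α : ℝ} (hα : α ≤ 1) :
    {x | α ≤ empiricalCDF Xs n ω t x}.Nonempty := by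
  obtain ⟨b, hb⟩ := ((Finset.range n).image fun i => Xs i ω t).bddAbove
  refine ⟨b, hα.trans_eq ?_⟩
  have hsum : ∑ i ∈ Finset.range n, (Set.Iic b).indicator (fun _ => (1 : ℝ)) (Xs i ω t) = n := by
    rw [Finset.sum_congr rfl fun i hi => Set.indicator_of_mem (Set.mem_Iic.2
      (hb (Finset.mem_coe.2 (Finset.mem_image_of_mem _ hi)))) _]
    simp
  rw [empiricalCDF, hsum, one_div, inv_mul_cancel₀ (Nat.cast_ne_zero.2 hn)]

theorem memℓp_empiricalProcess {E Ω₀ Ω : Type*} [MeasurableSpace Ω₀] {P : Measure Ω₀}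
    [IsProbabilityMeasure P] {X : Ω₀ → E → ℝ} {Xs : ℕ → Ω → E → ℝ} (n : ℕ) (ω : Ω) :
    Memℓp (E := fun _ : E × ℝ => ℝ) (empiricalProcess P X Xs n ω) ∞ := by
  refine memℓp_infty_of_abs_le (C := √(n : ℝ) * 1) fun s => ?_
  rw [empiricalProcess, abs_mul, abs_of_nonneg (Real.sqrt_nonneg _)]
  gcongr
  rw [abs_le]
  have h₁ : 0 ≤ marginalCDF P X s.1 s.2 := measureReal_nonneg
  have h₂ : marginalCDF P X s.1 s.2 ≤ 1 := measureReal_le_one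
  constructor <;> linarith [empiricalCDF_nonneg (Xs := Xs) n ω s.1 s.2,
    empiricalCDF_le_one (Xs := Xs) n ω s.1 s.2]

end EmpiricalCDF

/-! ### Inversion of a monotone function near a smooth one -/

section Inversion

/-- If `H` is monotone and close to the continuous increasing function `F`, and if `r (H - F)`
oscillates by at most `w` over the points where `F` is `δ`-close to `α`, then
`r (F(H⁻¹(α)) - α)` is within `w` of `-r (H - F)(F⁻¹(α))`. Comparing `H` with `α` only strictly to
the left and strictly to the right of `H⁻¹(α)` makes the jumps of `H` irrelevant. -/
theorem abs_mul_leftInverse_sub_add_le {F H : ℝ → ℝ} (hF : Continuous F) (hH : Monotone H)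
    {α τ r δ η w : ℝ} (hr : 0 ≤ r) (hne : {x | α ≤ H x}.Nonempty) (hbdd : BddBelow {x | α ≤ H x})
    (hclose : ∀ x, |H x - F x| ≤ η) (hηδ : η < δ)
    (hosc : ∀ x, |F x - α| ≤ δ → |r * (H x - F x) - r * (H τ - F τ)| ≤ w) :
    |F (leftInverse H α) - α| ≤ η ∧
      |r * (F (leftInverse H α) - α) + r * (H τ - F τ)| ≤ w := by
  set τ' := leftInverse H α with hτ'
  have hlt : ∀ x < τ', H x < α := fun x hx =>
    not_le.1 (notMem_of_lt_csInf (s := {x | α ≤ H x}) hx hbdd)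
  have hgt : ∀ x > τ', α ≤ H x := fun x hx => by
    obtain ⟨y, hy, hyx⟩ := exists_lt_of_csInf_lt hne hx
    exact hy.trans (hH hyx.le)
  have hleft : Tendsto F (𝓝[<] τ') (𝓝 (F τ')) := hF.continuousAt.mono_left nhdsWithin_le_nhds
  have hright : Tendsto F (𝓝[>] τ') (𝓝 (F τ')) := hF.continuousAt.mono_left nhdsWithin_le_nhds
  have habs : |F τ' - α| ≤ η := by
    rw [abs_le]
    constructor
    · have : α - η ≤ F τ' := ge_of_tendsto hright (by
        filter_upwards [self_mem_nhdsWithin] with x hx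
        linarith [hgt x hx, (abs_le.1 (hclose x)).2])
      linarith
    · have : F τ' ≤ α + η := le_of_tendsto hleft (by
        filter_upwards [self_mem_nhdsWithin] with x hx
        linarith [hlt x hx, (abs_le.1 (hclose x)).1])
      linarith
  refine ⟨habs, ?_⟩
  have hnear : ∀ᶠ x in 𝓝 τ', |F x - α| < δ :=
    ((hF.sub continuous_const).abs.continuousAt).eventually (gt_mem_nhds (habs.trans_lt hηδ))
  rw [abs_le]
  constructor
  · have : -w - r * (H τ - F τ) ≤ r * (F τ' - α) :=
      ge_of_tendsto ((hright.sub_const α).const_mul r) (by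
        filter_upwards [self_mem_nhdsWithin, hnear.filter_mono nhdsWithin_le_nhds] with x hx hxδ
        have h₁ := mul_le_mul_of_nonneg_left (hgt x hx) hr
        linarith [(abs_le.1 (hosc x hxδ.le)).2])
    linarith
  · have : r * (F τ' - α) ≤ w - r * (H τ - F τ) :=
      le_of_tendsto ((hleft.sub_const α).const_mul r) (by
        filter_upwards [self_mem_nhdsWithin, hnear.filter_mono nhdsWithin_le_nhds] with x hx hxδ
        have h₁ := mul_le_mul_of_nonneg_left (hlt x hx).le hr
        linarith [(abs_le.1 (hosc x hxδ.le)).1])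
    linarith

/-- The linearization error of `F` at `τ`, when the derivative `f` of `F` is at least `c` and
oscillates by at most `ε` on the interval of radius `θ` about `τ`. -/
theorem abs_sub_sub_mul_le_of_abs_sub_lt {F f : ℝ → ℝ} (hF : ∀ x, HasDerivAt F (f x) x)
    (hmono : Monotone F) {τ τ' θ c ε : ℝ} (hθ : 0 < θ) (hc : 0 < c)
    (hlow : ∀ x, |x - τ| ≤ θ → c ≤ f x) (hosc : ∀ x, |x - τ| ≤ θ → |f x - f τ| ≤ ε)
    (hclose : |F τ' - F τ| < c * θ) :
    |F τ' - F τ - (τ' - τ) * f τ| ≤ ε / c * |F τ' - F τ| := by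
  have hmvt : ∀ x y, x < y → ∃ ξ ∈ Set.Ioo x y, F y - F x = (y - x) * f ξ := fun x y hxy => by
    obtain ⟨ξ, hξ, h⟩ := exists_hasDerivAt_eq_slope F f hxy
      (continuous_iff_continuousAt.2 fun z => (hF z).continuousAt).continuousOn fun z _ => hF z
    refine ⟨ξ, hξ, ?_⟩
    rw [h, mul_div_cancel₀ _ (sub_pos.2 hxy).ne']
  have hgrow : ∀ x y, x < y → (∀ ξ ∈ Set.Ioo x y, |ξ - τ| ≤ θ) → c * (y - x) ≤ F y - F x :=
    fun x y hxy h => by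
      obtain ⟨ξ, hξ, hslope⟩ := hmvt x y hxy
      rw [hslope, mul_comm]
      exact mul_le_mul_of_nonneg_left (hlow ξ (h ξ hξ)) (sub_pos.2 hxy).le
  -- the values of `F` at `τ ± θ` are too far from `F τ` for `τ'` to lie outside `[τ - θ, τ + θ]`
  have hle : |τ' - τ| ≤ θ := by
    rw [abs_lt] at hclose
    rw [abs_le]
    constructor
    · by_contra! h
      have h₁ := hgrow (τ - θ) τ (by linarith) fun ξ hξ => by
        rw [abs_le]
        constructor <;> linarith [hξ.1, hξ.2]
      have h₂ := hmono (show τ' ≤ τ - θ by linarith)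
      linarith
    · by_contra! h
      have h₁ := hgrow τ (τ + θ) (by linarith) fun ξ hξ => by
        rw [abs_le]
        constructor <;> linarith [hξ.1, hξ.2]
      have h₂ := hmono (show τ + θ ≤ τ' by linarith)
      linarith
  obtain ⟨ξ, hξ, hslope⟩ : ∃ ξ, |ξ - τ| ≤ θ ∧ F τ' - F τ = (τ' - τ) * f ξ := by
    rw [abs_le] at hle
    rcases lt_trichotomy τ' τ with h | h | h
    · obtain ⟨ξ, hξ, hs⟩ := hmvt τ' τ h
      exact ⟨ξ, abs_le.2 ⟨by linarith [hξ.1], by linarith [hξ.2]⟩, by linarith⟩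
    · exact ⟨τ, by simpa using hθ.le, by simp [h]⟩
    · obtain ⟨ξ, hξ, hs⟩ := hmvt τ τ' h
      exact ⟨ξ, abs_le.2 ⟨by linarith [hξ.1], by linarith [hξ.2]⟩, hs⟩
  rw [hslope, ← mul_sub, abs_mul, abs_mul, abs_of_pos (hc.trans_le (hlow ξ hξ))]
  have h₁ : c ≤ f ξ := hlow ξ hξ
  have h₂ : |f ξ - f τ| ≤ ε := hosc ξ hξ
  have hε : 0 ≤ ε := (abs_nonneg _).trans h₂
  calc |τ' - τ| * |f ξ - f τ| ≤ |τ' - τ| * ε := by gcongr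
    _ = ε / c * (|τ' - τ| * c) := by field_simp
    _ ≤ ε / c * (|τ' - τ| * f ξ) := by gcongr

end Inversion

/-! ### Increments of the limit process -/

section Increments

variable {E Ω₀ Ω Ω' : Type*} [MeasurableSpace Ω₀] [MeasurableSpace Ω] [MeasurableSpace Ω']
  {P : Measure Ω₀} [IsProbabilityMeasure P] {Q : Measure Ω} {Q' : Measure Ω'}
  {X : Ω₀ → E → ℝ} {Xs : ℕ → Ω → E → ℝ} {G : Ω' → E × ℝ → ℝ}

theorem EmpiricalCLT.integral_mul_of_le (hX : Measurable X) (hCLT : EmpiricalCLT P X Q Xs Q' G)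
    (t : E) {x y : ℝ} (hxy : x ≤ y) :
    ∫ ω, G ω (t, x) * G ω (t, y) ∂Q' =
      marginalCDF P X t x - marginalCDF P X t x * marginalCDF P X t y := by
  rw [hCLT.covariance]
  set p := marginalCDF P X t x with hp
  set q := marginalCDF P X t y with hq
  have hXt : Measurable fun ω => X ω t := (measurable_pi_apply t).comp hX
  have hm : ∀ z, MeasurableSet {ω | X ω t ≤ z} := fun z => hXt measurableSet_Iic
  have hint : ∀ z, Integrable ({ω | X ω t ≤ z}.indicator fun _ => (1 : ℝ)) P := fun z =>
    (integrable_const _).indicator (hm z)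
  have hval : ∀ z, ∫ ω, {ω | X ω t ≤ z}.indicator (fun _ => (1 : ℝ)) ω ∂P =
      marginalCDF P X t z := fun z => by
    rw [integral_indicator_const _ (hm z), smul_eq_mul, mul_one, marginalCDF]
  have hprod : ∀ ω, ((Set.Iic x).indicator (fun _ => (1 : ℝ)) (X ω t) - p) *
      ((Set.Iic y).indicator (fun _ => (1 : ℝ)) (X ω t) - q) =
      (1 - q) * {ω | X ω t ≤ x}.indicator (fun _ => (1 : ℝ)) ω -
        p * {ω | X ω t ≤ y}.indicator (fun _ => (1 : ℝ)) ω + p * q := fun ω => by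
    by_cases h₁ : X ω t ≤ x
    · have h₂ := h₁.trans hxy
      simp only [Set.indicator, Set.mem_Iic, Set.mem_ofPred_eq, h₁, h₂, if_true]
      ring
    · simp only [Set.indicator, Set.mem_Iic, Set.mem_ofPred_eq, h₁, if_false]
      ring
  have hdiff : Integrable (fun ω => (1 - q) * {ω | X ω t ≤ x}.indicator (fun _ => (1 : ℝ)) ω -
      p * {ω | X ω t ≤ y}.indicator (fun _ => (1 : ℝ)) ω) P :=
    ((hint x).const_mul _).sub ((hint y).const_mul _)
  simp only [hprod]
  rw [integral_add hdiff (integrable_const _),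
    integral_sub ((hint x).const_mul _) ((hint y).const_mul _), integral_const_mul,
    integral_const_mul, hval, hval, integral_const, probReal_univ, one_smul, ← hp, ← hq]
  ring

/-- Chebyshev's inequality for the increments of the limit process in its second variable: they
are small in probability where the increments of the distribution function are small. -/
theorem EmpiricalCLT.measure_le_abs_sub_le (hX : Measurable X)
    (hCLT : EmpiricalCLT P X Q Xs Q' G) (t : E) (x y : ℝ) {ε : ℝ} (hε : 0 < ε) :
    Q' {ω | ε ≤ |G ω (t, x) - G ω (t, y)|} ≤
      ENNReal.ofReal (|marginalCDF P X t x - marginalCDF P X t y| / ε ^ 2) := by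
  wlog hxy : x ≤ y generalizing x y
  · simpa only [abs_sub_comm] using this y x (le_of_not_ge hxy)
  have hG := hCLT.clt.limit.gaussian
  have := hG.isProbabilityMeasure
  have hmem : ∀ z, MemLp (fun ω => G ω (t, z)) 2 Q' := fun z =>
    (hG.hasGaussianLaw_eval (t, z)).memLp_two
  have hint : ∀ z, Integrable (fun ω => G ω (t, z)) Q' := fun z =>
    (hG.hasGaussianLaw_eval (t, z)).integrable
  have hsub : MemLp (fun ω => G ω (t, x) - G ω (t, y)) 2 Q' := (hmem x).sub (hmem y)
  have hmean : ∫ ω, (G ω (t, x) - G ω (t, y)) ∂Q' = 0 := by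
    rw [integral_sub (hint x) (hint y), hCLT.clt.limit.centered, hCLT.clt.limit.centered, sub_zero]
  have hvar : Var[fun ω => G ω (t, x) - G ω (t, y); Q'] ≤
      |marginalCDF P X t x - marginalCDF P X t y| := by
    have hmul : ∀ z z', Integrable (fun ω => G ω (t, z) * G ω (t, z')) Q' := fun z z' =>
      (hmem z).integrable_mul (hmem z')
    have hsq : ∀ ω, (G ω (t, x) - G ω (t, y)) ^ 2 = G ω (t, x) * G ω (t, x) -
        2 * (G ω (t, x) * G ω (t, y)) + G ω (t, y) * G ω (t, y) := fun ω => by ring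
    have hdiff : Integrable (fun ω => G ω (t, x) * G ω (t, x) - 2 * (G ω (t, x) * G ω (t, y))) Q' :=
      (hmul x x).sub ((hmul x y).const_mul 2)
    rw [variance_of_integral_eq_zero hsub.aestronglyMeasurable.aemeasurable hmean]
    simp only [hsq]
    rw [integral_add hdiff (hmul y y),
      integral_sub (hmul x x) ((hmul x y).const_mul 2), integral_const_mul,
      hCLT.integral_mul_of_le hX t le_rfl, hCLT.integral_mul_of_le hX t hxy,
      hCLT.integral_mul_of_le hX t le_rfl]
    have h₁ := neg_abs_le (marginalCDF P X t x - marginalCDF P X t y)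
    linarith [sq_nonneg (marginalCDF P X t x - marginalCDF P X t y)]
  have hcheb := meas_ge_le_variance_div_sq hsub hε
  rw [hmean] at hcheb
  simp only [sub_zero] at hcheb
  exact hcheb.trans (ENNReal.ofReal_le_ofReal (by gcongr))

/-- Up to small outer probability, the paths of the empirical processes are eventually bounded by
a constant and have small increments in the second variable over points where the distribution
functions are close, uniformly in the first variable. -/
theorem EmpiricalCLT.eventually_equicontinuous [IsProbabilityMeasure Q] (hX : Measurable X)
    (hCLT : EmpiricalCLT P X Q Xs Q' G) {ε η : ℝ} (hε : 0 < ε) (hη : 0 < η) :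
    ∃ A > (0 : ℝ), ∃ δ > (0 : ℝ), ∀ᶠ n in atTop, Q.real {ω | ¬ ((∀ t x,
      |(empiricalProcess P X Xs n ω (t, x))| ≤ A) ∧ ∀ t x y,
        |marginalCDF P X t x - marginalCDF P X t y| ≤ δ →
          |(empiricalProcess P X Xs n ω (t, x) - empiricalProcess P X Xs n ω (t, y))| ≤ ε)}
      ≤ η := by
  have hG := hCLT.clt.limit
  have := hG.isProbabilityMeasure_map
  have := hG.radon
  have hε' : 0 < ε / 7 := by positivity
  obtain ⟨K, hK, hμK, δ, hδ, hKδ⟩ := exists_isCompact_forall_abs_sub_le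
    (μ := Q'.map fun ω => toLInf (G ω)) (half_pos hη) hε'
  obtain ⟨A, hA⟩ := hK.isBounded.exists_norm_le
  have hK' : ∀ t x y, |marginalCDF P X t x - marginalCDF P X t y| ≤ δ * (ε / 7) ^ 2 / 2 →
      ∀ z ∈ K, |z (t, x) - z (t, y)| ≤ 5 * (ε / 7) := fun t x y hxy => by
    refine hKδ _ _ ?_
    have hcont : Continuous (fun z => |z (t, x) - z (t, y)| : LInf (E × ℝ) → ℝ) :=
      continuous_abs.comp ((LInf.continuous_eval (t, x)).sub (LInf.continuous_eval (t, y)))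
    rw [Measure.map_apply_of_aemeasurable hG.aemeasurable
      (measurableSet_le measurable_const hcont.measurable)]
    have hae : Q' ((fun ω => toLInf (G ω)) ⁻¹'
        {z : LInf (E × ℝ) | ε / 7 ≤ |z (t, x) - z (t, y)|}) ≤
        Q' {ω | ε / 7 ≤ |G ω (t, x) - G ω (t, y)|} := by
      refine measure_mono_ae ?_
      filter_upwards [hG.bounded] with ω hω h
      have h' : ε / 7 ≤ |toLInf (G ω) (t, x) - toLInf (G ω) (t, y)| := h
      rwa [toLInf_apply hω, toLInf_apply hω] at h'
    refine (hae.trans (hCLT.measure_le_abs_sub_le hX t x y hε')).trans_lt ?_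
    refine (ENNReal.ofReal_lt_ofReal_iff hδ).2 ?_
    rw [div_lt_iff₀ (by positivity)]
    have : 0 < δ * (ε / 7) ^ 2 := by positivity
    linarith
  refine ⟨|A| + ε / 7, by positivity, δ * (ε / 7) ^ 2 / 2, by positivity, ?_⟩
  have hconv : ∀ h : LInf (E × ℝ) →ᵇ ℝ, Tendsto (fun n => upperExpectation Q fun ω =>
      h (toLInf (empiricalProcess P X Xs n ω))) atTop
      (𝓝 (∫ x, h x ∂(Q'.map fun ω => toLInf (G ω)))) := fun h => by
    rw [hG.integral_map_eq h]
    exact hCLT.clt.tendsto h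
  filter_upwards [eventually_measureReal_notMem_thickening_le hconv hμK (half_pos hη) hε'] with n hn
  refine (measureReal_mono ?_).trans (hn.trans_eq (by ring))
  intro ω hω hmem
  refine hω ?_
  obtain ⟨z, hz, hdist⟩ := Metric.mem_thickening_iff.1 hmem
  have happ : ∀ s, |(empiricalProcess P X Xs n ω s - z s)| ≤ ε / 7 := fun s => by
    have := LInf.abs_apply_sub_le_dist (toLInf (empiricalProcess P X Xs n ω)) z s
    rw [toLInf_apply (memℓp_empiricalProcess n ω)] at this
    exact this.trans hdist.le
  refine ⟨fun t x => ?_, fun t x y hxy => ?_⟩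
  · have h₁ := abs_le.1 (happ (t, x))
    have h₂ := abs_le.1 (((LInf.abs_apply_le_norm z (t, x)).trans (hA z hz)).trans (le_abs_self A))
    rw [abs_le]
    constructor <;> linarith
  · have h₁ := abs_le.1 (happ (t, x))
    have h₂ := abs_le.1 (happ (t, y))
    have h₃ := abs_le.1 (hK' t x y hxy z hz)
    rw [abs_le]
    constructor <;> linarith

end Increments

/-! ### Linearization of the empirical quantiles -/

section Linearization

variable {E Ω₀ Ω Ω' : Type*} [MeasurableSpace Ω₀] [MeasurableSpace Ω] [MeasurableSpace Ω']
  {P : Measure Ω₀} [IsProbabilityMeasure P] {Q : Measure Ω} [IsProbabilityMeasure Q]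
  {Q' : Measure Ω'} {X : Ω₀ → E → ℝ} {Xs : ℕ → Ω → E → ℝ} {G : Ω' → E × ℝ → ℝ} {f : E → ℝ → ℝ}

/-- The Bahadur representation in its weak form: the normalized quantile process differs from the
negative empirical process at the true quantile by an error that tends to `0` in outer probability,
uniformly in `t` and `α`. -/
theorem EmpiricalCLT.tendsto_abs_quantile_add (hX : Measurable X)
    (hF : ∀ t, StrictMono (marginalCDF P X t)) (hf : HasMarginalDensities P X f)
    (hfuc : UniformlyContinuousDensities f) (hfpos : DensitiesBoundedBelow P X f)
    (hCLT : EmpiricalCLT P X Q Xs Q' G) {a b : ℝ} (ha : 0 < a) (hab : a ≤ b) (hb : b < 1)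
    {ε : ℝ} (hε : 0 < ε) :
    Tendsto (fun n : ℕ => Q.real {ω | ¬ ∀ s : E × Set.Icc a b,
      |√(n : ℝ) * (empiricalQuantile Xs n ω s.2 s.1 - quantile P X s.2 s.1) *
          f s.1 (quantile P X s.2 s.1) +
        empiricalProcess P X Xs n ω (s.1, quantile P X s.2 s.1)| ≤ ε}) atTop (𝓝 0) := by
  refine tendsto_order.2 ⟨fun c hc => Eventually.of_forall fun n => hc.trans_le measureReal_nonneg,
    fun η hη => ?_⟩
  obtain ⟨A, hA, δ, hδ, hev⟩ :=
    hCLT.eventually_equicontinuous hX (half_pos hε) (half_pos hη)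
  obtain ⟨θ₀, hθ₀, c, hc, hlow⟩ := hfpos a b ha hab hb
  -- the oscillation of `f` that makes the linearization error at most `ε / 2`
  obtain ⟨δ', hδ', hosc⟩ := hfuc (c * (ε / 2 / (A + ε / 2))) (by positivity)
  have hθ : 0 < min θ₀ δ' := lt_min hθ₀ hδ'
  have hsmall : Tendsto (fun n : ℕ => A / √(n : ℝ)) atTop (𝓝 0) :=
    (Real.tendsto_sqrt_atTop.comp tendsto_natCast_atTop_atTop).const_div_atTop A
  filter_upwards [hev, hsmall.eventually (gt_mem_nhds hδ),
    hsmall.eventually (gt_mem_nhds (mul_pos hc hθ)), eventually_ne_atTop 0] with n hn hnδ hnθ hn0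
  refine (measureReal_mono ?_).trans_lt (hn.trans_lt (half_lt_self hη))
  intro ω hω hgood
  obtain ⟨hbdd, hinc⟩ := hgood
  refine hω fun s => ?_
  obtain ⟨t, α, hα⟩ := s
  have hα01 : α ∈ Set.Ioo (0 : ℝ) 1 := ⟨ha.trans_le hα.1, hα.2.trans_lt hb⟩
  have hr : 0 < √(n : ℝ) := Real.sqrt_pos.2 (Nat.cast_pos.2 (Nat.pos_of_ne_zero hn0))
  have hder := hasDerivAt_marginalCDF hX hf hfuc t
  have hFc : Continuous (marginalCDF P X t) :=
    continuous_iff_continuousAt.2 fun x => (hder x).continuousAt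
  have hτ : marginalCDF P X t (quantile P X α t) = α := marginalCDF_quantile hX (hF t) hFc hα01
  have hclose : ∀ x, |empiricalCDF Xs n ω t x - marginalCDF P X t x| ≤ A / √(n : ℝ) := fun x => by
    have h := hbdd t x
    rw [empiricalProcess, abs_mul, abs_of_pos hr] at h
    rwa [le_div_iff₀ hr, mul_comm]
  obtain ⟨h₁, h₂⟩ := abs_mul_leftInverse_sub_add_le (α := α) (τ := quantile P X α t) (δ := δ)
    (w := ε / 2) hFc (empiricalCDF_mono n ω t) hr.le (nonempty_le_empiricalCDF hn0 ω t hα01.2.le)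
    (bddBelow_le_empiricalCDF n ω t hα01.1) hclose hnδ
    fun x hx => hinc t x (quantile P X α t) (by rwa [hτ])
  have h₃ := abs_sub_sub_mul_le_of_abs_sub_lt (τ := quantile P X α t)
    (τ' := empiricalQuantile Xs n ω α t) hder (hF t).monotone hθ hc
    (fun x hx => hlow t α hα x (hx.trans (min_le_left _ _)))
    (fun x hx => hosc t x _ (hx.trans (min_le_right _ _)))
    (by rw [hτ]; exact h₁.trans_lt hnθ)
  rw [hτ, mul_div_cancel_left₀ _ hc.ne'] at h₃
  change |√(n : ℝ) * (marginalCDF P X t (empiricalQuantile Xs n ω α t) - α) +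
    empiricalProcess P X Xs n ω (t, quantile P X α t)| ≤ ε / 2 at h₂
  set u := marginalCDF P X t (empiricalQuantile Xs n ω α t) - α
  set v := (empiricalQuantile Xs n ω α t - quantile P X α t) * f t (quantile P X α t) with hv
  set ν := empiricalProcess P X Xs n ω (t, quantile P X α t) with hν
  have h₄ : √(n : ℝ) * |u| ≤ A + ε / 2 := by
    have hνA : |ν| ≤ A := hbdd t _
    have habs : |√(n : ℝ) * u| = √(n : ℝ) * |u| := by rw [abs_mul, abs_of_pos hr]
    rw [← habs, abs_le]
    rw [abs_le] at h₂ hνA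
    constructor <;> linarith
  have h₅ : |√(n : ℝ) * v - √(n : ℝ) * u| ≤ ε / 2 := by
    rw [← mul_sub, abs_mul, abs_of_pos hr, abs_sub_comm]
    calc √(n : ℝ) * |u - v| ≤ √(n : ℝ) * (ε / 2 / (A + ε / 2) * |u|) := by gcongr
      _ = ε / 2 / (A + ε / 2) * (√(n : ℝ) * |u|) := by ring
      _ ≤ ε / 2 / (A + ε / 2) * (A + ε / 2) := by gcongr
      _ = ε / 2 := div_mul_cancel₀ _ (by positivity)
  change |√(n : ℝ) * (empiricalQuantile Xs n ω α t - quantile P X α t) *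
    f t (quantile P X α t) + ν| ≤ ε
  rw [mul_assoc, ← hv]
  rw [abs_le] at h₂ h₅ ⊢
  constructor <;> linarith

/-- The central limit theorem for the normalized quantile process multiplied by a bounded weight. -/
theorem EmpiricalCLT.satisfiesCLT_mul_quantile (hX : Measurable X)
    (hF : ∀ t, StrictMono (marginalCDF P X t)) (hf : HasMarginalDensities P X f)
    (hfuc : UniformlyContinuousDensities f) (hfpos : DensitiesBoundedBelow P X f)
    (hCLT : EmpiricalCLT P X Q Xs Q' G) {a b : ℝ} (ha : 0 < a) (hab : a ≤ b) (hb : b < 1)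
    (m : E × Set.Icc a b → ℝ) {C : ℝ} (hm : ∀ s, |m s| ≤ C) :
    SatisfiesCLT Q
      (fun (n : ℕ) (ω : Ω) (s : E × Set.Icc a b) => m s *
        (√(n : ℝ) * (empiricalQuantile Xs n ω s.2 s.1 - quantile P X s.2 s.1) *
          f s.1 (quantile P X s.2 s.1)))
      Q' (fun ω s => m s * G ω (s.1, quantile P X s.2 s.1)) := by
  have hm' : ∀ s, |-m s| ≤ C := fun s => by rw [abs_neg]; exact hm s
  have key := hCLT.clt.weightedComp_of_tendsto (Y' := fun (n : ℕ) ω s => m s *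
        (√(n : ℝ) * (empiricalQuantile Xs n ω s.2 s.1 - quantile P X s.2 s.1) *
          f s.1 (quantile P X s.2 s.1)))
    (fun s : E × Set.Icc a b => (s.1, quantile P X s.2 s.1)) (fun s => -m s) hm' fun ε hε => by
      refine squeeze_zero (fun _ => measureReal_nonneg) (fun n => measureReal_mono ?_)
        (hCLT.tendsto_abs_quantile_add hX hF hf hfuc hfpos ha hab hb
          (show 0 < ε / (|C| + 1) by positivity))
      intro ω hω hgood
      refine hω fun s => ?_
      rw [weightedComp_apply, toLInf_apply (memℓp_empiricalProcess n ω), neg_mul, sub_neg_eq_add,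
        ← mul_add, abs_mul]
      calc _ ≤ (|C| + 1) * (ε / (|C| + 1)) :=
            mul_le_mul ((hm s).trans ((le_abs_self C).trans (le_add_of_nonneg_right zero_le_one)))
              (hgood s) (abs_nonneg _) (by positivity)
        _ = ε := mul_div_cancel₀ _ (by positivity)
  -- the sign is immaterial, as the Gaussian limit law is symmetric
  simpa only [neg_mul, neg_neg] using key.neg_limit

end Linearization

/-! ### The two central limit theorems for quantiles -/

theorem mainTheorem4 {E Ω₀ Ω Ω' : Type*}
    [MeasurableSpace Ω₀] [MeasurableSpace Ω] [MeasurableSpace Ω']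
    (P : Measure Ω₀) [IsProbabilityMeasure P]
    (Q : Measure Ω) [IsProbabilityMeasure Q]
    (Q' : Measure Ω') [IsProbabilityMeasure Q']
    (X : Ω₀ → E → ℝ) (hX : Measurable X)
    (Xs : ℕ → Ω → E → ℝ) (hXs : ∀ j, Measurable (Xs j))
    (hindep : iIndepFun Xs Q) (hident : ∀ j, IdentDistrib (Xs j) X Q P)
    (hF : ∀ t, StrictMono (marginalCDF P X t))
    (f : E → ℝ → ℝ) (hf : HasMarginalDensities P X f)
    (hfuc : UniformlyContinuousDensities f)
    (hfpos : DensitiesBoundedBelow P X f)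
    (G : Ω' → E × ℝ → ℝ) (hCLT : EmpiricalCLT P X Q Xs Q' G)
    (a b : ℝ) (ha : 0 < a) (hab : a ≤ b) (hb : b < 1) :
    SatisfiesCLT Q
        (fun (n : ℕ) (ω : Ω) (s : E × Set.Icc a b) =>
          √(n : ℝ) * (empiricalQuantile Xs n ω s.2 s.1 - quantile P X s.2 s.1) *
            f s.1 (quantile P X s.2 s.1))
        Q' (fun (ω : Ω') (s : E × Set.Icc a b) => G ω (s.1, quantile P X s.2 s.1)) ∧
      SatisfiesCLT Q
        (fun (n : ℕ) (ω : Ω) (s : E × Set.Icc a b) =>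
          √(n : ℝ) * (empiricalQuantile Xs n ω s.2 s.1 - quantile P X s.2 s.1))
        Q' (fun (ω : Ω') (s : E × Set.Icc a b) =>
          G ω (s.1, quantile P X s.2 s.1) / f s.1 (quantile P X s.2 s.1)) := by
  obtain ⟨θ, hθ, c, hc, hlow⟩ := hfpos a b ha hab hb
  have hfτ : ∀ s : E × Set.Icc a b, c ≤ f s.1 (quantile P X s.2 s.1) := fun s =>
    hlow s.1 s.2 s.2.2 _ (by simpa using hθ.le)
  refine ⟨?_, ?_⟩
  · simpa only [one_mul] using hCLT.satisfiesCLT_mul_quantile hX hF hf hfuc hfpos ha hab hb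
      (fun _ => 1) (C := 1) (by simp)
  · have key := hCLT.satisfiesCLT_mul_quantile hX hF hf hfuc hfpos ha hab hb
      (fun s => (f s.1 (quantile P X s.2 s.1))⁻¹) (C := c⁻¹) fun s => by
        rw [abs_of_pos (inv_pos.2 (hc.trans_le (hfτ s)))]
        exact inv_anti₀ hc (hfτ s)
    convert key using 4 with n ω s ω s
    · rw [mul_comm _⁻¹, mul_inv_cancel_right₀ (hc.trans_le (hfτ s)).ne']
    · rw [div_eq_inv_mul]
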